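/- Let $n\ge 2$. Let $\mathfrak{sl}(n,\mathbb{H})$ be the real Lie algebra of quaternionic $n\times n$ matrices whose trace has zero real part, with its usual topology as a finite-dimensional real vector space, and let $\mathrm{Sl}(n,\mathbb{H})$ be the group of quaternionic $n\times n$ matrices $g$ with $|\det g|=1$, where $|\det g|\ge 0$ is the absolute value of the Dieudonné determinant (the square root of the determinant of the complex $2n\times 2n$ matrix representing $g$). It acts on $\mathfrak{sl}(n,\mathbb{H})$ by $\mathrm{Ad}(g)X=gXg^{-1}$. Say that $B\in\mathfrak{sl}(n,\mathbb{H})$ satisfies condition H2 if $$B=\mathrm{diag}\{a_1+ib_1,\ldots,a_n+ib_n\},\qquad a_r,b_r\in\mathbb{R},$$ with $a_1>a_2\ge\cdots\ge a_{n-1}>a_n$ (that is, $a_1\ge\cdots\ge a_n$, $a_1>a_2$ and $a_{n-1}>a_n$; for $n=2$ this means $a_1>a_2$), $b_1\neq 0\neq b_n$ and $b_1/b_n$ irrational. Let $$D=\{\mathrm{Ad}(g)B : g\in \mathrm{Sl}(n,\mathbb{H}),\ B\in\mathfrak{sl}(n,\mathbb{H})\text{ satisfies H2}\}.$$ Then $D$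 is dense in $\mathfrak{sl}(n,\mathbb{H})$. -/

import Mathlib

open scoped Quaternion

noncomputable section

namespace QuatSl

attribute [local instance] LieRing.ofAssociativeRing

/-- Writing a quaternion as `q = z + w j` with `z, w` complex, this is the component `z`. -/
def cpart (q : ℍ) : ℂ := ⟨q.re, q.imI⟩

/-- Writing a quaternion as `q = z + w j` with `z, w` complex, this is the component `w`. -/
def jpart (q : ℍ) : ℂ := ⟨q.imJ, q.imK⟩

/-- The standard embedding of quaternionic `n × n` matrices into complex `2n × 2n` matrices:
for `A = Z + W j` with `Z, W` complex, it is the block matrix with rows `(Z, W)` and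
`(-conj W, conj Z)`. -/
def toComplex {n : ℕ} (A : Matrix (Fin n) (Fin n) ℍ) :
    Matrix (Fin n ⊕ Fin n) (Fin n ⊕ Fin n) ℂ :=
  Matrix.fromBlocks (A.map cpart) (A.map jpart)
    (-(A.map fun q => star (jpart q))) (A.map fun q => star (cpart q))

theorem cpart_sum {ι : Type*} (s : Finset ι) (f : ι → ℍ) :
    cpart (∑ i ∈ s, f i) = ∑ i ∈ s, cpart (f i) := by
  classical
  induction s using Finset.induction_on with
  | empty => simp [cpart, Complex.ext_iff]
  | insert a s ha ih =>
    rw [Finset.sum_insert ha, Finset.sum_insert ha, ← ih]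
    simp [cpart, Complex.ext_iff]

theorem jpart_sum {ι : Type*} (s : Finset ι) (f : ι → ℍ) :
    jpart (∑ i ∈ s, f i) = ∑ i ∈ s, jpart (f i) := by
  classical
  induction s using Finset.induction_on with
  | empty => simp [jpart, Complex.ext_iff]
  | insert a s ha ih =>
    rw [Finset.sum_insert ha, Finset.sum_insert ha, ← ih]
    simp [jpart, Complex.ext_iff]

theorem cpart_mul (p q : ℍ) :
    cpart (p * q) = cpart p * cpart q - jpart p * star (jpart q) := by
  simp [cpart, jpart, Complex.ext_iff]
  constructor <;> ring

theorem jpart_mul (p q : ℍ) :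
    jpart (p * q) = cpart p * jpart q + jpart p * star (cpart q) := by
  simp [cpart, jpart, Complex.ext_iff]
  constructor <;> ring

theorem toComplex_one {n : ℕ} : toComplex (1 : Matrix (Fin n) (Fin n) ℍ) = 1 := by
  ext i j
  rcases i with i | i <;> rcases j with j | j <;> by_cases h : i = j <;>
    simp [toComplex, Matrix.one_apply, h, cpart, jpart, Complex.ext_iff]

theorem toComplex_mul {n : ℕ} (A B : Matrix (Fin n) (Fin n) ℍ) :
    toComplex (A * B) = toComplex A * toComplex B := by
  unfold toComplex
  rw [Matrix.fromBlocks_multiply]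
  congr 1 <;> ext1 i j <;>
    simp only [Matrix.map_apply, Matrix.mul_apply, Matrix.add_apply, Matrix.neg_apply,
      cpart_sum, jpart_sum, cpart_mul, jpart_mul, star_sum, star_sub, star_add, star_mul',
      star_star, ← Finset.sum_add_distrib, ← Finset.sum_neg_distrib] <;>
    refine Finset.sum_congr rfl fun k _ => ?_ <;> ring

/-- The absolute value `|det g|` of the (Dieudonné) determinant of a quaternionic matrix: the
complex determinant of the associated `2n × 2n` matrix is a nonnegative real, equal to
`|det g| ^ 2`. -/
def absDet {n : ℕ} (A : Matrix (Fin n) (Fin n) ℍ) : ℝ :=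
  Real.sqrt ‖(toComplex A).det‖

theorem absDet_one {n : ℕ} : absDet (1 : Matrix (Fin n) (Fin n) ℍ) = 1 := by
  simp [absDet, toComplex_one]

theorem absDet_mul {n : ℕ} (A B : Matrix (Fin n) (Fin n) ℍ) :
    absDet (A * B) = absDet A * absDet B := by
  simp [absDet, toComplex_mul]

/-- The group `Sl(n, ℍ)` of invertible quaternionic matrices `g` with `|det g| = 1`. -/
def SlGroup (n : ℕ) : Subgroup (Matrix (Fin n) (Fin n) ℍ)ˣ where
  carrier := {g | absDet (g : Matrix (Fin n) (Fin n) ℍ) = 1}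
  one_mem' := absDet_one
  mul_mem' {g h} hg hh := by
    simp only [Set.mem_ofPred_eq] at hg hh ⊢
    rw [Units.val_mul, absDet_mul, hg, hh, one_mul]
  inv_mem' {g} hg := by
    simp only [Set.mem_ofPred_eq] at hg ⊢
    have h := absDet_mul (g : Matrix (Fin n) (Fin n) ℍ) (g⁻¹ : (Matrix (Fin n) (Fin n) ℍ)ˣ)
    rw [Units.mul_inv, absDet_one, hg, one_mul] at h
    exact h.symm

theorem re_sum {ι : Type*} (s : Finset ι) (f : ι → ℍ) :
    (∑ i ∈ s, f i).re = ∑ i ∈ s, (f i).re := by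
  have h := congrArg Complex.re (cpart_sum s f)
  rw [Complex.re_sum] at h
  exact h

theorem re_trace_mul_comm {n : ℕ} (A B : Matrix (Fin n) (Fin n) ℍ) :
    (A * B).trace.re = (B * A).trace.re := by
  simp only [Matrix.trace, Matrix.diag, Matrix.mul_apply, re_sum]
  rw [Finset.sum_comm]
  refine Finset.sum_congr rfl fun i _ => Finset.sum_congr rfl fun j _ => ?_
  simp only [Quaternion.re_mul]
  ring

/-- The real Lie algebra `𝔰𝔩(n, ℍ)` of quaternionic matrices whose trace has zero real part. -/
def slAlg (n : ℕ) : LieSubalgebra ℝ (Matrix (Fin n) (Fin n) ℍ) where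
  carrier := {A | A.trace.re = 0}
  add_mem' {A B} hA hB := by
    simp only [Set.mem_ofPred_eq] at hA hB ⊢
    simp [Matrix.trace_add, hA, hB]
  zero_mem' := by simp
  smul_mem' c A hA := by
    simp only [Set.mem_ofPred_eq] at hA ⊢
    simp [Matrix.trace_smul, hA]
  lie_mem' {A B} _ _ := by
    change (⁅A, B⁆).trace.re = 0
    rw [Ring.lie_def, Matrix.trace_sub, Quaternion.re_sub, re_trace_mul_comm, sub_self]

theorem mem_slAlg {n : ℕ} (A : Matrix (Fin n) (Fin n) ℍ) : A ∈ slAlg n ↔ A.trace.re = 0 :=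
  Iff.rfl

/-- The adjoint action `Ad(g) X = g X g⁻¹` of `Sl(n, ℍ)` on `𝔰𝔩(n, ℍ)`. -/
def Ad {n : ℕ} (g : SlGroup n) (X : slAlg n) : slAlg n :=
  ⟨g.1.val * X.1 * g.1⁻¹.val, by
    rw [mem_slAlg, re_trace_mul_comm, ← mul_assoc, Units.inv_mul, one_mul]
    exact X.2⟩

/-- Condition H2 (for `n ≥ 2`): `B = diag(a₁ + i b₁, …, aₙ + i bₙ)` with
`a₁ > a₂ ≥ ⋯ ≥ aₙ₋₁ > aₙ`, `b₁ ≠ 0 ≠ bₙ` and `b₁ / bₙ` irrational.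
Indices are shifted by one, as `Fin n = {0, …, n - 1}`. -/
def CondH2 {n : ℕ} (hn : 2 ≤ n) (B : slAlg n) : Prop :=
  ∃ a b : Fin n → ℝ,
    (B : Matrix (Fin n) (Fin n) ℍ) = Matrix.diagonal (fun r => (((⟨a r, b r⟩ : ℂ)) : ℍ)) ∧
    Antitone a ∧
    a ⟨1, by omega⟩ < a ⟨0, by omega⟩ ∧
    a ⟨n - 1, by omega⟩ < a ⟨n - 2, by omega⟩ ∧
    b ⟨0, by omega⟩ ≠ 0 ∧ b ⟨n - 1, by omega⟩ ≠ 0 ∧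
    Irrational (b ⟨0, by omega⟩ / b ⟨n - 1, by omega⟩)

/-- The set `D` of all `Ad`-conjugates of matrices satisfying H2. -/
def conjH2 {n : ℕ} (hn : 2 ≤ n) : Set (slAlg n) :=
  {X | ∃ g : SlGroup n, ∃ B : slAlg n, CondH2 hn B ∧ X = Ad g B}

end QuatSl

end

open scoped Quaternion

namespace QuatSl

open Matrix

/-! The proof works among all quaternionic matrices, with arbitrary invertible conjugators. Right
eigenvectors exist because complex `2n × 2n` matrices have eigenvalues, so each matrix is similar to
a block triangular one with a complex corner `l`. By induction on the size, the lower block can be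
approximated by a split one; then the real part of `l` is moved off finitely many values, and a
Sylvester equation removes the off-diagonal row. Hence split matrices are dense (`dense_isSplit`).
Perturbing only the first and last imaginary parts makes their ratio irrational (`dense_isConjH2`).
Removing the real trace is a continuous surjection onto `slAlg n`, so it preserves density. It
shifts all real parts equally, and the conjugator can be rescaled into `SlGroup n`; strictly
decreasing real parts give more than H2 requires. -/

/-- A quaternionic matrix is *split* if it is similar to a complex diagonal matrix whose entries
have pairwise distinct real parts. -/
def IsSplit {ι : Type*} [Fintype ι] [DecidableEq ι] (X : Matrix ι ι ℍ) : Prop :=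
  ∃ g : (Matrix ι ι ℍ)ˣ, ∃ z : ι → ℂ, Function.Injective (fun i => (z i).re) ∧
    X * g.val = g.val * diagonal (fun i => (z i : ℍ))

/-! ### Right eigenvectors -/

/-- The quaternion `x + j y`, for complex `x` and `y`. -/
noncomputable def ofPair (x y : ℂ) : ℍ := ⟨x.re, x.im, y.re, -y.im⟩

theorem cpart_ofPair (x y : ℂ) : cpart (ofPair x y) = x := by
  simp [cpart, ofPair]

theorem jpart_ofPair (x y : ℂ) : jpart (ofPair x y) = star y := by
  simp [jpart, ofPair, Complex.ext_iff]

theorem cpart_jpart_ext {p q : ℍ} (h₁ : cpart p = cpart q) (h₂ : jpart p = jpart q) : p = q := by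
  simp only [cpart, jpart, Complex.ext_iff] at h₁ h₂
  exact QuaternionAlgebra.ext h₁.1 h₁.2 h₂.1 h₂.2

theorem cpart_coe (z : ℂ) : cpart (z : ℍ) = z := by
  simp [cpart]

theorem jpart_coe (z : ℂ) : jpart (z : ℍ) = 0 := by
  simp [jpart, Complex.ext_iff]

/-- Every nonempty square quaternionic matrix has a right eigenvector with complex eigenvalue. -/
theorem exists_right_eigenvector {n : ℕ} (X : Matrix (Fin (n + 1)) (Fin (n + 1)) ℍ) :
    ∃ (v : Fin (n + 1) → ℍ) (l : ℂ), v ≠ 0 ∧ ∀ i, ∑ j, X i j * v j = v i * (l : ℍ) := by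
  obtain ⟨l, hl⟩ := Module.End.exists_eigenvalue (Matrix.toLin' (toComplex X))
  obtain ⟨w, hw⟩ := hl.exists_hasEigenvector
  have hw0 := hw.2
  have hw1 := hw.apply_eq_smul
  rw [Matrix.toLin'_apply] at hw1
  -- The first complex column representing `x + j y` is `(x, -y)`, whence the sign. Right
  -- multiplication by the complex number `l` scales that column by `l`.
  refine ⟨fun i => ofPair (w (Sum.inl i)) (-w (Sum.inr i)), l, ?_, fun i => ?_⟩
  · intro h
    apply hw0
    ext i
    rcases i with i | i
    · have := congrArg cpart (congrFun h i)
      rw [cpart_ofPair] at this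
      simpa [cpart, Complex.ext_iff] using this
    · have := congrArg jpart (congrFun h i)
      rw [jpart_ofPair] at this
      simpa [jpart, Complex.ext_iff] using this
  · have e₁ := congrFun hw1 (Sum.inl i)
    have e₂ := congrArg star (congrFun hw1 (Sum.inr i))
    simp only [toComplex, mulVec, dotProduct, Fintype.sum_sum_type, fromBlocks_apply₁₁,
      fromBlocks_apply₁₂, fromBlocks_apply₂₁, fromBlocks_apply₂₂, map_apply, Pi.smul_apply,
      smul_eq_mul, Matrix.neg_apply, star_add, star_sum, star_mul', star_neg, star_star] at e₁ e₂
    apply cpart_jpart_ext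
    · rw [cpart_sum, cpart_mul, cpart_coe, jpart_coe, cpart_ofPair]
      simp only [cpart_mul, cpart_ofPair, jpart_ofPair, star_star, mul_neg, sub_neg_eq_add,
        Finset.sum_add_distrib, e₁, star_zero, mul_zero, sub_zero]
      ring
    · rw [jpart_sum, jpart_mul, cpart_coe, jpart_coe, jpart_ofPair]
      simp only [jpart_mul, cpart_ofPair, jpart_ofPair, star_neg, mul_neg, mul_zero, zero_add,
        Finset.sum_add_distrib, Finset.sum_neg_distrib]
      simp only [neg_mul, Finset.sum_neg_distrib] at e₂
      linear_combination -e₂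

/-! ### Splitting block triangular matrices -/

/-- The Sylvester equation `u d - l u = w` is solvable when `d` and `l` have distinct real
parts. -/
theorem exists_sylvester {d l : ℍ} (h : d.re ≠ l.re) (w : ℍ) : ∃ u : ℍ, u * d - l * u = w := by
  let f : ℍ →ₗ[ℝ] ℍ := LinearMap.mulRight ℝ d - LinearMap.mulLeft ℝ l
  have hf : Function.Injective f := by
    rw [injective_iff_map_eq_zero]
    intro u hu
    -- A nonzero kernel element would make `d` and `l` conjugate, but conjugation preserves the real
    -- part.
    by_contra hu0
    have h1 : u * d = l * u := sub_eq_zero.1 hu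
    have h2 : d = u⁻¹ * (l * u) := by rw [← h1, inv_mul_cancel_left₀ hu0]
    apply h
    have h3 : ∀ p q : ℍ, (p * q).re = (q * p).re := fun p q => by
      simp only [Quaternion.re_mul]; ring
    rw [h2, h3, mul_assoc, mul_inv_cancel₀ hu0, mul_one]
  exact (LinearMap.injective_iff_surjective.1 hf) w

theorem IsSplit.conj {ι : Type*} [Fintype ι] [DecidableEq ι] {X : Matrix ι ι ℍ}
    (hX : IsSplit X) (h : (Matrix ι ι ℍ)ˣ) : IsSplit (h.val * X * h⁻¹.val) := by
  obtain ⟨g, z, hz, e⟩ := hX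
  refine ⟨h * g, z, hz, ?_⟩
  rw [Units.val_mul, mul_assoc, ← mul_assoc h⁻¹.val, Units.inv_mul, one_mul, mul_assoc, e,
    mul_assoc]

theorem IsSplit.submatrix {ι κ : Type*} [Fintype ι] [DecidableEq ι] [Fintype κ] [DecidableEq κ]
    {X : Matrix ι ι ℍ} (hX : IsSplit X) (e : κ ≃ ι) : IsSplit (X.submatrix e e) := by
  obtain ⟨g, z, hz, h⟩ := hX
  refine ⟨⟨g.val.submatrix e e, g⁻¹.val.submatrix e e, ?_, ?_⟩, z ∘ e, hz.comp e.injective, ?_⟩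
  · rw [submatrix_mul_equiv, Units.mul_inv, submatrix_one_equiv]
  · rw [submatrix_mul_equiv, Units.inv_mul, submatrix_one_equiv]
  · have : diagonal (fun i => ((z ∘ e) i : ℍ)) = (diagonal fun i => (z i : ℍ)).submatrix e e := by
      rw [submatrix_diagonal_equiv]; rfl
    rw [this]
    simp only [submatrix_mul_equiv, h]

/-- A block triangular matrix whose lower right block is split is split, when the real part of
its upper left entry avoids the spectrum of that block. -/
theorem isSplit_fromBlocks {ι : Type*} [Fintype ι] [DecidableEq ι] {l : ℂ} {w : Matrix Unit ι ℍ}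
    {Y : Matrix ι ι ℍ} {g : (Matrix ι ι ℍ)ˣ} {z : ι → ℂ}
    (hz : Function.Injective (fun i => (z i).re))
    (hY : Y * g.val = g.val * diagonal (fun i => (z i : ℍ))) (hl : ∀ i, (z i).re ≠ l.re) :
    IsSplit (fromBlocks (diagonal fun _ : Unit => (l : ℍ)) w 0 Y) := by
  -- Comparing upper right blocks in `X * G = G * D`, with `G = fromBlocks 1 U 0 g`, gives exactly
  -- this equation for each column of `U`.
  have hs (i : ι) : ∃ u : ℍ, u * (z i : ℍ) - (l : ℍ) * u = (w * g.val) () i :=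
    exists_sylvester (by simpa using hl i) _
  choose u hu using hs
  let U : Matrix Unit ι ℍ := of fun _ i => u i
  refine ⟨⟨fromBlocks 1 U 0 g.val, fromBlocks 1 (-(U * g⁻¹.val)) 0 g⁻¹.val, ?_, ?_⟩,
    Sum.elim (fun _ => l) z, ?_, ?_⟩
  · simp [fromBlocks_multiply, fromBlocks_one]
  · simp [fromBlocks_multiply, fromBlocks_one, Matrix.mul_assoc]
  · rintro (i | i) (j | j) h
    · rfl
    · exact absurd h.symm (hl j)
    · exact absurd h (hl i)
    · exact congrArg _ (hz h)
  · have hd : diagonal (fun i => ((Sum.elim (fun _ : Unit => l) z i : ℂ) : ℍ)) =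
        fromBlocks (diagonal fun _ : Unit => (l : ℍ)) 0 0 (diagonal fun i => (z i : ℍ)) := by
      rw [fromBlocks_diagonal]
      congr 1
      funext i
      rcases i with i | i <;> rfl
    rw [hd]
    simp only [fromBlocks_multiply, hY]
    congr 1
    · simp
    · ext1 i j
      simp only [Matrix.add_apply, diagonal_mul, mul_diagonal, Matrix.mul_zero,
        Matrix.zero_apply, zero_add, U, of_apply, ← hu j]
      abel
    · simp
    · simp

/-! ### Density of split matrices -/

theorem continuous_coe_mk {α : Type*} [TopologicalSpace α] {f g : α → ℝ} (hf : Continuous f)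
    (hg : Continuous g) : Continuous fun t => (((⟨f t, g t⟩ : ℂ)) : ℍ) :=
  (LinearMap.continuous_of_finiteDimensional Quaternion.ofComplex.toLinearMap).comp
    (Complex.equivRealProdCLM.symm.continuous.comp (hf.prodMk hg))

/-- Split matrices accumulate at each block triangular matrix with complex upper left entry and
lower right block in the closure of the split matrices. -/
theorem fromBlocks_mem_closure_isSplit {ι : Type*} [Fintype ι] [DecidableEq ι] (l : ℂ)
    (w : Matrix Unit ι ℍ) {Y : Matrix ι ι ℍ} (hY : Y ∈ closure {Y | IsSplit Y}) :
    fromBlocks (diagonal fun _ : Unit => (l : ℍ)) w 0 Y ∈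
      closure {X : Matrix (Unit ⊕ ι) (Unit ⊕ ι) ℍ | IsSplit X} := by
  have hc : Continuous fun Y : Matrix ι ι ℍ =>
      fromBlocks (diagonal fun _ : Unit => (l : ℍ)) w 0 Y :=
    continuous_const.matrix_fromBlocks continuous_const continuous_const continuous_id
  -- Two successive approximations: first `Y` by a split block, then, with that block fixed, `l` by
  -- a value with admissible real part.
  rw [← closure_closure (s := {X : Matrix (Unit ⊕ ι) (Unit ⊕ ι) ℍ | IsSplit X})]
  refine map_mem_closure hc hY ?_
  rintro Y ⟨g, z, hz, e⟩
  let F : ℝ → Matrix (Unit ⊕ ι) (Unit ⊕ ι) ℍ := fun t =>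
    fromBlocks (diagonal fun _ : Unit => (((⟨t, l.im⟩ : ℂ)) : ℍ)) w 0 Y
  have hF : Continuous F := by
    have h1 : Continuous fun t : ℝ => (((⟨t, l.im⟩ : ℂ)) : ℍ) :=
      continuous_coe_mk continuous_id continuous_const
    exact (Continuous.matrix_diagonal (continuous_pi fun _ => h1)).matrix_fromBlocks
      continuous_const continuous_const continuous_const
  have hd : Dense (Set.range fun i => (z i).re)ᶜ := (Set.finite_range _).countable.dense_compl ℝ
  exact map_mem_closure (f := F) hF (hd l.re) fun t ht =>
    isSplit_fromBlocks (l := ⟨t, l.im⟩) hz e fun i hi => ht ⟨i, hi⟩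

/-- Each quaternionic matrix of size `n + 1` is similar to a block triangular one. -/
theorem exists_conj_fromBlocks {n : ℕ} (X : Matrix (Fin (n + 1)) (Fin (n + 1)) ℍ) :
    ∃ (e : Fin (n + 1) ≃ Unit ⊕ Fin n) (h : (Matrix (Unit ⊕ Fin n) (Unit ⊕ Fin n) ℍ)ˣ) (l : ℂ)
      (w : Matrix Unit (Fin n) ℍ) (Y : Matrix (Fin n) (Fin n) ℍ),
      X = (h.val * fromBlocks (diagonal fun _ : Unit => (l : ℍ)) w 0 Y * h⁻¹.val).submatrix
        e e := by
  obtain ⟨v, l, hv, hX⟩ := exists_right_eigenvector X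
  obtain ⟨k, hk⟩ := Function.ne_iff.1 hv
  -- The pivot index `k`, where `v k ≠ 0`, goes to the `Unit` block, so that the matrix `h` below is
  -- invertible.
  let e : Fin (n + 1) ≃ Unit ⊕ Fin n :=
    (finSuccEquiv' k).trans ((Equiv.optionEquivSumPUnit _).trans (Equiv.sumComm _ _))
  have hek : e.symm (Sum.inl ()) = k := by simp [e]
  let p : Matrix Unit Unit ℍ := of fun _ _ => v k
  let p' : Matrix Unit Unit ℍ := of fun _ _ => (v k)⁻¹
  have hk' : v k ≠ 0 := hk
  have hp : p * p' = 1 := by ext1 i j; simp [p, p', Matrix.mul_apply, hk']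
  have hp' : p' * p = 1 := by ext1 i j; simp [p, p', Matrix.mul_apply, hk']
  let q : Matrix (Fin n) Unit ℍ := of fun i _ => v (e.symm (Sum.inr i))
  -- The first column of `h` is the eigenvector, so the first column of `h⁻¹ X' h` is `l` times the
  -- first basis vector.
  let h : (Matrix (Unit ⊕ Fin n) (Unit ⊕ Fin n) ℍ)ˣ :=
    ⟨fromBlocks p 0 q 1, fromBlocks p' 0 (-(q * p')) 1,
      by simp [fromBlocks_multiply, fromBlocks_one, hp],
      by simp [fromBlocks_multiply, fromBlocks_one, hp', Matrix.mul_assoc]⟩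
  let X' := X.submatrix e.symm e.symm
  let N := h⁻¹.val * X' * h.val
  have hcol : ∀ i, h.val i (Sum.inl ()) = v (e.symm i) := by
    rintro (i | i)
    · simp [h, p, hek]
    · simp [h, q]
  have hXh : ∀ i, (X' * h.val) i (Sum.inl ()) = h.val i (Sum.inl ()) * (l : ℍ) := by
    intro i
    simp only [Matrix.mul_apply, hcol, X', submatrix_apply]
    rw [← hX, ← e.symm.sum_comp]
  have hN : ∀ i, N i (Sum.inl ()) =
      (1 : Matrix (Unit ⊕ Fin n) (Unit ⊕ Fin n) ℍ) i (Sum.inl ()) * (l : ℍ) := by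
    intro i
    simp only [N]
    rw [Matrix.mul_assoc, Matrix.mul_apply]
    simp only [hXh, ← mul_assoc]
    rw [← Finset.sum_mul, ← Matrix.mul_apply, Units.inv_mul]
  refine ⟨e, h, l, N.toBlocks₁₂, N.toBlocks₂₂, ?_⟩
  have hNb : fromBlocks (diagonal fun _ : Unit => (l : ℍ)) N.toBlocks₁₂ 0 N.toBlocks₂₂ = N := by
    conv_rhs => rw [← fromBlocks_toBlocks N]
    congr 1
    · ext1 i j
      have := hN (Sum.inl ())
      simp only [one_apply_eq, one_mul] at this
      simp [toBlocks₁₁, this]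
    · ext1 i j
      have := hN (Sum.inr i)
      simp only [ne_eq, reduceCtorEq, not_false_eq_true, one_apply_ne, zero_mul] at this
      simp [toBlocks₂₁, this]
  rw [hNb]
  have : h.val * N * h⁻¹.val = X' := by
    simp only [N, ← mul_assoc, Units.mul_inv, one_mul]
    rw [mul_assoc, Units.mul_inv, mul_one]
  rw [this]
  ext1 i j
  simp [X']

theorem dense_isSplit (n : ℕ) : Dense {X : Matrix (Fin n) (Fin n) ℍ | IsSplit X} := by
  induction n with
  | zero =>
    intro X
    exact subset_closure ⟨1, fun _ => 0, fun i => i.elim0, Subsingleton.elim _ _⟩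
  | succ n ih =>
    intro X
    obtain ⟨e, h, l, w, Y, rfl⟩ := exists_conj_fromBlocks X
    have hc : Continuous fun M : Matrix (Unit ⊕ Fin n) (Unit ⊕ Fin n) ℍ =>
        (h.val * M * h⁻¹.val).submatrix e e :=
      ((continuous_const.matrix_mul continuous_id).matrix_mul continuous_const).matrix_submatrix
        e e
    exact map_mem_closure
      (f := fun M : Matrix (Unit ⊕ Fin n) (Unit ⊕ Fin n) ℍ => (h.val * M * h⁻¹.val).submatrix e e)
      hc (fromBlocks_mem_closure_isSplit l w (ih Y)) fun M hM => (IsSplit.conj hM h).submatrix e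

/-- The eigenvalues of a split matrix can be listed by decreasing real part. -/
theorem IsSplit.exists_strictAnti {n : ℕ} {X : Matrix (Fin n) (Fin n) ℍ} (hX : IsSplit X) :
    ∃ (g : (Matrix (Fin n) (Fin n) ℍ)ˣ) (a b : Fin n → ℝ), StrictAnti a ∧
      X = g.val * diagonal (fun i => (((⟨a i, b i⟩ : ℂ)) : ℍ)) * g⁻¹.val := by
  obtain ⟨g, z, hz, e⟩ := hX
  -- Sorting the negatives lists the real parts in decreasing order; `g'` permutes the columns of
  -- `g` accordingly.
  let s : Equiv.Perm (Fin n) := Tuple.sort fun i => -(z i).re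
  have hs : Monotone ((fun i => -(z i).re) ∘ s) := Tuple.monotone_sort _
  let g' : (Matrix (Fin n) (Fin n) ℍ)ˣ :=
    ⟨g.val.submatrix id s, g⁻¹.val.submatrix s id,
      by rw [submatrix_mul_equiv, Units.mul_inv, submatrix_id_id],
      by rw [← submatrix_mul _ _ _ id _ Function.bijective_id, Units.inv_mul,
        submatrix_one_equiv]⟩
  refine ⟨g', fun i => (z (s i)).re, fun i => (z (s i)).im, ?_, ?_⟩
  · refine Antitone.strictAnti_of_injective (fun i j hij => ?_) (hz.comp s.injective)
    simpa using hs hij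
  · rw [Units.eq_mul_inv_iff_mul_eq]
    have hd : diagonal (fun i => (((⟨(z (s i)).re, (z (s i)).im⟩ : ℂ)) : ℍ)) =
        (diagonal fun i => (z i : ℍ)).submatrix s s := by
      rw [submatrix_diagonal_equiv]; rfl
    have h1 : X * g.val.submatrix id s = (X * g.val).submatrix id s := by
      rw [submatrix_mul _ _ _ id _ Function.bijective_id, submatrix_id_id]
    change X * g.val.submatrix id s = g.val.submatrix id s * _
    rw [hd, submatrix_mul_equiv, h1, e]

/-! ### Irrational ratio of imaginary parts -/

/-- The matrices similar to a diagonal matrix as in condition H2, without constraint on the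
trace. -/
def IsConjH2 {n : ℕ} (hn : 2 ≤ n) (X : Matrix (Fin n) (Fin n) ℍ) : Prop :=
  ∃ (g : (Matrix (Fin n) (Fin n) ℍ)ˣ) (a b : Fin n → ℝ), StrictAnti a ∧
    b ⟨n - 1, by omega⟩ ≠ 0 ∧ Irrational (b ⟨0, by omega⟩ / b ⟨n - 1, by omega⟩) ∧
    X = g.val * diagonal (fun i => (((⟨a i, b i⟩ : ℂ)) : ℍ)) * g⁻¹.val

theorem dense_irrational_div : Dense {p : ℝ × ℝ | p.2 ≠ 0 ∧ Irrational (p.1 / p.2)} := by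
  rintro ⟨x, y⟩
  rw [← closure_closure (s := {p : ℝ × ℝ | p.2 ≠ 0 ∧ Irrational (p.1 / p.2)})]
  -- The denominator is moved off zero first; then, with it fixed at `t`, the ratio is approximated
  -- by irrationals `r` through `(r * t, t)`.
  refine map_mem_closure (f := fun t : ℝ => (x, t)) (by fun_prop)
    ((Set.countable_singleton (0 : ℝ)).dense_compl ℝ y) fun t ht => ?_
  have ht0 : t ≠ 0 := ht
  have := map_mem_closure (f := fun r : ℝ => (r * t, t)) (by fun_prop)
    (dense_irrational (x / t)) (t := {p : ℝ × ℝ | p.2 ≠ 0 ∧ Irrational (p.1 / p.2)})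
    fun r hr => ⟨ht0, by simpa [ht0] using hr⟩
  simpa [ht0] using this

theorem dense_isConjH2 {n : ℕ} (hn : 2 ≤ n) : Dense {X | IsConjH2 hn X} := by
  suffices h : {X | IsSplit X} ⊆ closure {X | IsConjH2 hn X} by
    intro X
    exact closure_minimal h isClosed_closure (dense_isSplit n X)
  intro X hX
  obtain ⟨g, a, b, ha, rfl⟩ := IsSplit.exists_strictAnti hX
  let i₀ : Fin n := ⟨0, by omega⟩
  let i₁ : Fin n := ⟨n - 1, by omega⟩
  -- This uses `2 ≤ n`: the two entries can be varied independently.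
  have h01 : i₀ ≠ i₁ := by simp only [ne_eq, Fin.mk.injEq, i₀, i₁]; omega
  let β : ℝ × ℝ → Fin n → ℝ := fun p => Function.update (Function.update b i₀ p.1) i₁ p.2
  have hβ : Continuous β := by fun_prop
  let F : ℝ × ℝ → Matrix (Fin n) (Fin n) ℍ := fun p =>
    g.val * diagonal (fun i => (((⟨a i, β p i⟩ : ℂ)) : ℍ)) * g⁻¹.val
  have hF : Continuous F := by
    have h1 (i : Fin n) : Continuous fun p => (((⟨a i, β p i⟩ : ℂ)) : ℍ) :=
      continuous_coe_mk continuous_const ((continuous_apply i).comp hβ)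
    exact (continuous_const.matrix_mul (Continuous.matrix_diagonal (continuous_pi h1))).matrix_mul
      continuous_const
  have hb : β (b i₀, b i₁) = b := by simp [β]
  have := map_mem_closure (f := F) hF (dense_irrational_div (b i₀, b i₁)) (t := {X | IsConjH2 hn X})
    fun p hp => ⟨g, a, β p, ha, ?_, ?_, rfl⟩
  · simpa only [F, hb] using this
  · simpa [β, i₁] using hp.1
  · have e₀ : β p i₀ = p.1 := by simp [β, h01]
    have e₁ : β p i₁ = p.2 := by simp [β]
    change Irrational (β p i₀ / β p i₁)
    rw [e₀, e₁]
    exact hp.2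

/-! ### Normalising trace and determinant -/

/-- The projection onto `𝔰𝔩(n, ℍ)` along the real scalar matrices. -/
noncomputable def traceless {n : ℕ} (hn : 2 ≤ n) (X : Matrix (Fin n) (Fin n) ℍ) : slAlg n :=
  ⟨X - (X.trace.re / n) • (1 : Matrix (Fin n) (Fin n) ℍ), by
    have : (n : ℝ) ≠ 0 := by positivity
    rw [mem_slAlg, trace_sub, trace_smul, trace_one]
    simp
    field_simp
    simp⟩

theorem continuous_traceless {n : ℕ} (hn : 2 ≤ n) : Continuous (traceless hn) := by
  refine Continuous.subtype_mk ?_ _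
  have : Continuous fun X : Matrix (Fin n) (Fin n) ℍ => X.trace.re :=
    Quaternion.continuous_re.comp continuous_id.matrix_trace
  exact continuous_id.sub ((this.div_const _).smul continuous_const)

theorem surjective_traceless {n : ℕ} (hn : 2 ≤ n) : Function.Surjective (traceless hn) := by
  intro X
  refine ⟨X.1, Subtype.ext ?_⟩
  have : X.1.trace.re = 0 := X.2
  simp [traceless, this]

/-- The complex determinant of size `2n` scales by `c ^ (2n)`, and the square root halves the
exponent. -/
theorem absDet_smul {n : ℕ} {c : ℝ} (hc : 0 ≤ c) (A : Matrix (Fin n) (Fin n) ℍ) :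
    absDet (c • A) = c ^ n * absDet A := by
  have : toComplex (c • A) = (c : ℂ) • toComplex A := by
    ext i j
    rcases i with i | i <;> rcases j with j | j <;>
      simp [toComplex, cpart, jpart, Complex.ext_iff]
  rw [absDet, this, det_smul, Fintype.card_sum, Fintype.card_fin, norm_mul, norm_pow,
    Complex.norm_real, Real.norm_of_nonneg hc, Real.sqrt_mul (by positivity), pow_add,
    Real.sqrt_mul_self (by positivity), absDet]

/-- Conjugation by an invertible matrix agrees with conjugation by an element of `Sl(n, ℍ)`. -/
theorem exists_slGroup_conj_eq {n : ℕ} (hn : n ≠ 0) (g : (Matrix (Fin n) (Fin n) ℍ)ˣ) :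
    ∃ h : SlGroup n, ∀ X, g.val * X * g⁻¹.val = h.1.val * X * h.1⁻¹.val := by
  have hg : 0 < absDet g.val := by
    have h1 := absDet_mul g.val g⁻¹.val
    rw [Units.mul_inv, absDet_one] at h1
    refine lt_of_le_of_ne (Real.sqrt_nonneg _) fun h => ?_
    rw [← h, zero_mul] at h1
    exact one_ne_zero h1
  -- Chosen so that `c ^ n` cancels `absDet g`; a nonzero real scalar does not affect conjugation.
  let c : ℝ := (absDet g.val)⁻¹ ^ (n : ℝ)⁻¹
  have hc : 0 < c := Real.rpow_pos_of_pos (inv_pos.2 hg) _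
  have hcn : c ^ n = (absDet g.val)⁻¹ := Real.rpow_inv_natCast_pow (inv_pos.2 hg).le hn
  refine ⟨⟨⟨c • g.val, c⁻¹ • g⁻¹.val, ?_, ?_⟩, ?_⟩, fun X => ?_⟩
  · simp [smul_smul, hc.ne']
  · simp [smul_smul, hc.ne']
  · change absDet (c • g.val) = 1
    rw [absDet_smul hc.le, hcn, inv_mul_cancel₀ hg.ne']
  · change _ = c • g.val * X * c⁻¹ • g⁻¹.val
    simp [smul_smul, hc.ne']

theorem traceless_mem_conjH2 {n : ℕ} (hn : 2 ≤ n) {X : Matrix (Fin n) (Fin n) ℍ}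
    (hX : IsConjH2 hn X) : traceless hn X ∈ conjH2 hn := by
  obtain ⟨g, a, b, ha, hb, hirr, hXg⟩ := hX
  obtain ⟨h, hh⟩ := exists_slGroup_conj_eq (by omega) g
  set c : ℝ := X.trace.re / n with hc
  let B : Matrix (Fin n) (Fin n) ℍ := diagonal (fun i => (((⟨a i - c, b i⟩ : ℂ)) : ℍ))
  have hB : B = diagonal (fun i => (((⟨a i, b i⟩ : ℂ)) : ℍ)) - c • 1 := by
    ext1 i j
    by_cases hij : i = j
    · subst hij
      ext <;> simp [B]
    · simp [B, hij]
  have hT : (traceless hn X).1 = h.1.val * B * h.1⁻¹.val := by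
    rw [← hh, hB, mul_sub, sub_mul, ← hXg]
    simp [traceless, hc]
  have hBm : B ∈ slAlg n := by
    have : B = h.1⁻¹.val * ((traceless hn X).1 * h.1.val) := by
      rw [hT, mul_assoc, Units.inv_mul, mul_one, ← mul_assoc, Units.inv_mul, one_mul]
    rw [mem_slAlg, this, re_trace_mul_comm, mul_assoc, Units.mul_inv, mul_one]
    exact (traceless hn X).2
  have ha' : StrictAnti fun i => a i - c := fun i j hij => sub_lt_sub_right (ha hij) c
  refine ⟨h, ⟨B, hBm⟩, ⟨fun i => a i - c, b, rfl, ha'.antitone, ha' ?_, ha' ?_, ?_, hb, hirr⟩,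
    Subtype.ext hT⟩
  · simp [Fin.lt_def]
  · simp only [Fin.lt_def]; omega
  -- A zero numerator would make the ratio zero, so irrationality already gives `b₁ ≠ 0`.
  · intro h0
    rw [h0, zero_div] at hirr
    exact not_irrational_zero hirr

end QuatSl

theorem mainTheorem6 (n : ℕ) (hn : 2 ≤ n) : Dense (QuatSl.conjH2 hn) := by
  refine Dense.mono (Set.image_subset_iff.2 fun X hX => QuatSl.traceless_mem_conjH2 hn hX)
    ((QuatSl.surjective_traceless hn).denseRange.dense_image (QuatSl.continuous_traceless hn)
      (QuatSl.dense_isConjH2 hn))
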